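/- **Stable point separation for random sub-sampled convolutions.** *Setting.* Let $n\ge 2$ and index the coordinates of $\mathbb R^n$ by $\mathbb Z/n\mathbb Z$. A random vector $\xi$ in $\mathbb R^n$ satisfies the *small-ball assumption* (SBA) with constant $\mathcal L$ if for every $1\le k\le n-1$, every $k$-dimensional subspace $F\subset\mathbb R^n$, every $z\in\mathbb R^n$ and every $\varepsilon>0$, $$\mathbb P\big(\|P_F\xi-z\|_2\le \varepsilon\sqrt k\big)\le(\mathcal L\varepsilon)^k,$$ where $P_F$ is the orthogonal projection onto $F$. For $a,x\in\mathbb R^n$ the discrete convolution is $a\circledast x=(\langle a,\tau_i x\rangle)_i$, where $(\tau_i x)_j=x_{j-i \bmod n}$. Let $\hat a=\mathcal F a/\sqrt n\in\mathbb C^n$, i.e. $\hat a_k=n^{-1/2}\sum_j a_j e^{-2\pi \mathrm{i} jk/n}$, be the normalized discrete Fourier transform, and let $\|\hat a\|_q=(\sum_k|\hat a_k|^q)^{1/q}$. A vector is $s$-sparse if it has at most $s$ nonzero coordinates. Let $(\delta_i)_i$ be independent $\{0,1\}$-valued random variables with mean $\delta$, such that the family $(\delta_i)_i$ is independent of $\xi$,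 and put $I=\{i:\delta_i=1\}$. *Theorem.* There are absolute constants $c_3,c_4,c_5>0$, and for every real $q>2$ there are constants $c_0,c_1,c_2>0$ depending only on $q$, such that the following holds for every $n\ge2$. Let $\xi$ satisfy the SBA with constant $\mathcal L$, and let $a\in S^{n-1}$ be $s$-sparse with $s\le c_0 n/\log n$. Then for every $0<\varepsilon<1$, with probability (with respect to both $\xi$ and $(\delta_i)_i$) at least $$1-(c_1\mathcal L\varepsilon)^{c_2/\|\hat a\|_q^{2q/(q-2)}}-\exp(-c_3\delta n),$$ both $$\sum_{i\in I}(a\circledast\xi)_i^2\ge c_4\varepsilon^2\delta n\qquad\text{and}\qquad \big|\{i\in I:|(a\circledast\xi)_i|\ge\varepsilon\}\big|\ge c_5\delta n$$ hold. -/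

import Mathlib

open MeasureTheory ProbabilityTheory
open scoped ZMod

noncomputable section

namespace SubsampledConvolution

/-- The small-ball assumption with constant `L` for a random vector `X` in `ℝ^ι`: for every
subspace `F` of dimension `k` with `1 ≤ k ≤ n - 1` (`n` is the number of coordinates), every
vector `z` and every `ε > 0`, one has `ℙ(‖P_F X - z‖₂ ≤ ε √k) ≤ (L ε)^k`, where `P_F` is the
orthogonal projection onto `F`. -/
def SmallBallAssumption {ι Ω : Type*} [Fintype ι] [MeasurableSpace Ω] (μ : Measure Ω)
    (X : Ω → EuclideanSpace ℝ ι) (L : ℝ) : Prop :=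
  ∀ (k : ℕ), 1 ≤ k → k < Fintype.card ι →
    ∀ F : Submodule ℝ (EuclideanSpace ℝ ι), Module.finrank ℝ F = k →
      ∀ (z : EuclideanSpace ℝ ι) (ε : ℝ), 0 < ε →
        μ.real {ω | ‖F.starProjection (X ω) - z‖ ≤ ε * √(k : ℝ)} ≤ (L * ε) ^ k

/-- The cyclic shift `τ_i x = (x_{j - i mod n})_j`; coordinates are indexed by `ℤ/nℤ`. -/
def cyclicShift {n : ℕ} (i : ZMod n) (x : EuclideanSpace ℝ (ZMod n)) :
    EuclideanSpace ℝ (ZMod n) :=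
  WithLp.toLp 2 (fun j => x (j - i))

/-- The discrete convolution `a ⊛ x = (⟨a, τ_i x⟩)_i`. -/
def circConv {n : ℕ} [NeZero n] (a x : EuclideanSpace ℝ (ZMod n)) :
    EuclideanSpace ℝ (ZMod n) :=
  WithLp.toLp 2 (fun i => inner ℝ a (cyclicShift i x))

/-- The normalized discrete Fourier transform `â = ℱ a / √n`. -/
def normalizedDFT {n : ℕ} [NeZero n] (a : EuclideanSpace ℝ (ZMod n)) : ZMod n → ℂ :=
  fun k => 𝓕 (fun j : ZMod n => ((a j : ℝ) : ℂ)) k / ((√(n : ℝ) : ℝ) : ℂ)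

/-- The `ℓ_q` norm of a finite complex vector, for `0 < q < ∞`. -/
def lqNorm {ι : Type*} [Fintype ι] (q : ℝ) (v : ι → ℂ) : ℝ :=
  (∑ i, ‖v i‖ ^ q) ^ (1 / q)

/-- `a` has at most `s` nonzero coordinates. -/
def IsSparse {ι : Type*} [Fintype ι] (s : ℕ) (a : EuclideanSpace ℝ ι) : Prop :=
  (Finset.univ.filter (fun i => a i ≠ 0)).card ≤ s

/-- The selectors of a random `δ`-selection: independent, `{0,1}`-valued random variables with
mean `δ`. -/
structure IsSelectorFamily {ι Ω : Type*} [MeasurableSpace Ω] (μ : Measure Ω) (δ : ℝ)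
    (sel : ι → Ω → ℝ) : Prop where
  measurable : ∀ i, Measurable (sel i)
  zero_or_one : ∀ i ω, sel i ω = 0 ∨ sel i ω = 1
  mean_eq : ∀ i, ∫ ω, sel i ω ∂μ = δ
  indep : iIndepFun sel μ

/-- The random set `I = {i : δ_i = 1}`. -/
def selectedSet {ι Ω : Type*} [Fintype ι] (sel : ι → Ω → ℝ) (ω : Ω) : Finset ι :=
  Finset.univ.filter (fun i => sel i ω = 1)

end SubsampledConvolution

end

noncomputable section

namespace SubsampledConvolution

open Finset ZMod ComplexConjugate

/-! ### Fourier analysis: energy of the shifts in a subspace -/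

section Fourier

variable {n : ℕ} [NeZero n]

/-! Each coordinate of `a ⊛ ξ` is the marginal of `ξ` along a shift of `a`, so the task is to find
many shifts that are quantitatively independent.

For a `d`-dimensional `F`, Parseval turns the energy `∑ ‖P_F τ_i a‖²` into `n ∑ |â_l|² p_l`, where
`p_l` is the energy of the `l`-th normalized character in `F`. Bessel gives `0 ≤ p_l ≤ 1`, Parseval
gives `∑ p_l = d`, and Hölder bounds the energy by `n ‖â‖_q² d^((q-2)/q)`. While `d` is at most a
constant times `‖â‖_q^(-2q/(q-2))`, this is at most `n/2`, so some shift is far from `F`. Greedy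
selection (`exists_sequentiallySeparated`) gives a block of about that many shifts, each far from
the span of its predecessors.

The Gram-Schmidt determinant of such a block is bounded below, so the small-ball bound for balls
passes to parallelepipeds. A union bound over half-blocks shows that at least half of the block's
marginals can be small only with small probability. Translates of the block obey the same bound;
Markov's inequality and double counting then give `n/4` coordinates of size at least `ε`. Since this
random set of coordinates is independent of the selectors, Chernoff's bound shows that a proportion
of order `δ` of it is selected. -/

lemma sum_dft_mul (Φ Ψ : ZMod n → ℂ) : ∑ k, 𝓕 Φ k * Ψ k = ∑ j, Φ j * 𝓕 Ψ j := by
  simp only [dft_apply, smul_eq_mul, sum_mul, mul_sum]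
  rw [sum_comm]
  refine sum_congr rfl fun j _ => sum_congr rfl fun k _ => ?_
  rw [mul_comm k j]
  ring

lemma conj_dft (Φ : ZMod n → ℂ) (k : ZMod n) :
    conj (𝓕 Φ k) = 𝓕 (fun j => conj (Φ (-j))) k := by
  simp only [dft_apply, smul_eq_mul, map_sum, map_mul]
  refine Fintype.sum_equiv (Equiv.neg _) _ _ fun j => ?_
  rw [← AddChar.map_neg_eq_conj]
  simp

/-- Parseval's identity for the discrete Fourier transform. -/
lemma sum_norm_sq_dft (Φ : ZMod n → ℂ) : ∑ k, ‖𝓕 Φ k‖ ^ 2 = n * ∑ j, ‖Φ j‖ ^ 2 := by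
  have h : ∑ k, 𝓕 Φ k * conj (𝓕 Φ k) = n * ∑ j, Φ j * conj (Φ j) := by
    simp only [conj_dft]
    -- The transform is self-adjoint for the bilinear pairing, and its square is `n` times the
    -- reflection, which undoes the reflection in `conj_dft`.
    rw [sum_dft_mul, dft_dft, mul_sum]
    refine sum_congr rfl fun j _ => ?_
    simp only [neg_neg, smul_eq_mul]
    ring
  simp only [Complex.mul_conj, Complex.normSq_eq_norm_sq] at h
  exact_mod_cast h

lemma circConv_apply (a x : EuclideanSpace ℝ (ZMod n)) (i : ZMod n) :
    circConv a x i = ∑ j, a j * x (j - i) := by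
  simp [circConv, cyclicShift, PiLp.inner_apply, mul_comm]

lemma circConv_eq_inner (a x : EuclideanSpace ℝ (ZMod n)) (i : ZMod n) :
    circConv a x i = inner ℝ (cyclicShift (-i) a) x := by
  rw [circConv_apply]
  simp only [cyclicShift, PiLp.inner_apply, RCLike.inner_apply, conj_trivial, sub_neg_eq_add]
  refine Fintype.sum_equiv (Equiv.subRight i) _ _ fun j => ?_
  simp [mul_comm]

/-- The conjugate appears because `a ⊛ u` is a correlation, with entries `∑ a_j u_{j-i}`. -/
lemma dft_circConv (a u : EuclideanSpace ℝ (ZMod n)) (l : ZMod n) :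
    𝓕 (fun j : ZMod n => ((circConv a u j : ℝ) : ℂ)) l =
      𝓕 (fun j : ZMod n => ((a j : ℝ) : ℂ)) l * conj (𝓕 (fun j : ZMod n => ((u j : ℝ) : ℂ)) l) := by
  rw [conj_dft]
  simp only [dft_apply, smul_eq_mul, Complex.conj_ofReal]
  rw [sum_mul_sum]
  simp only [circConv_apply, Complex.ofReal_sum, Complex.ofReal_mul, mul_sum]
  rw [sum_comm]
  refine sum_congr rfl fun j _ => ?_
  refine Fintype.sum_equiv (Equiv.subRight j) _ _ fun i => ?_
  have : stdAddChar (-(i * l)) = stdAddChar (-(j * l)) * stdAddChar (-((i - j) * l)) := by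
    rw [← AddChar.map_add_eq_mul]
    congr 1
    ring
  simp only [Equiv.subRight_apply, neg_sub, this]
  ring

lemma norm_normalizedDFT_sq (a : EuclideanSpace ℝ (ZMod n)) (l : ZMod n) :
    ‖normalizedDFT a l‖ ^ 2 = ‖𝓕 (fun j : ZMod n => ((a j : ℝ) : ℂ)) l‖ ^ 2 / n := by
  rw [normalizedDFT, norm_div, div_pow, Complex.norm_real, Real.norm_eq_abs, sq_abs,
    Real.sq_sqrt (Nat.cast_nonneg n)]

lemma sum_norm_sq_normalizedDFT (a : EuclideanSpace ℝ (ZMod n)) :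
    ∑ l, ‖normalizedDFT a l‖ ^ 2 = ‖a‖ ^ 2 := by
  have hn : (n : ℝ) ≠ 0 := Nat.cast_ne_zero.2 (NeZero.ne n)
  simp only [norm_normalizedDFT_sq, ← sum_div, sum_norm_sq_dft, EuclideanSpace.norm_sq_eq,
    Complex.norm_real]
  field_simp

lemma sum_circConv_sq (a u : EuclideanSpace ℝ (ZMod n)) :
    ∑ i, circConv a u i ^ 2 = n * ∑ l, ‖normalizedDFT a l‖ ^ 2 * ‖normalizedDFT u l‖ ^ 2 := by
  have hn : (n : ℝ) ≠ 0 := Nat.cast_ne_zero.2 (NeZero.ne n)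
  have h := sum_norm_sq_dft (fun j : ZMod n => ((circConv a u j : ℝ) : ℂ))
  simp only [dft_circConv, norm_mul, RCLike.norm_conj, mul_pow, Complex.norm_real,
    Real.norm_eq_abs, sq_abs] at h
  have h2 : ∀ l, ‖normalizedDFT a l‖ ^ 2 * ‖normalizedDFT u l‖ ^ 2 =
      ‖𝓕 (fun j : ZMod n => ((a j : ℝ) : ℂ)) l‖ ^ 2 *
        ‖𝓕 (fun j : ZMod n => ((u j : ℝ) : ℂ)) l‖ ^ 2 / n ^ 2 := fun l => by
    rw [norm_normalizedDFT_sq, norm_normalizedDFT_sq]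
    field_simp
  simp only [h2, ← sum_div, h]
  field_simp

/-- Bessel's inequality for the characters of `ℤ/nℤ`. -/
lemma sum_norm_sq_normalizedDFT_le_one {ι : Type*} [Fintype ι]
    {u : ι → EuclideanSpace ℝ (ZMod n)} (hu : Orthonormal ℝ u) (l : ZMod n) :
    ∑ m, ‖normalizedDFT (u m) l‖ ^ 2 ≤ 1 := by
  have hn : (0 : ℝ) < n := Nat.cast_pos.2 (NeZero.pos n)
  -- The vectors `u m` are real, so the character is split into real and imaginary parts; Bessel
  -- applies to each, and their squared norms sum to `n`.
  set x : EuclideanSpace ℝ (ZMod n) := WithLp.toLp 2 fun j => (stdAddChar (-(j * l))).re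
  set y : EuclideanSpace ℝ (ZMod n) := WithLp.toLp 2 fun j => (stdAddChar (-(j * l))).im
  have key : ∀ m, ‖normalizedDFT (u m) l‖ ^ 2 =
      (‖inner ℝ (u m) x‖ ^ 2 + ‖inner ℝ (u m) y‖ ^ 2) / n := fun m => by
    rw [norm_normalizedDFT_sq, ← Complex.normSq_eq_norm_sq, Complex.normSq_apply]
    simp [dft_apply, x, y, PiLp.inner_apply, pow_two]
  have hxy : ‖x‖ ^ 2 + ‖y‖ ^ 2 = n := by
    simp only [EuclideanSpace.norm_sq_eq, ← sum_add_distrib, x, y, Real.norm_eq_abs, sq_abs]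
    have : ∀ j : ZMod n, (stdAddChar (-(j * l)) : ℂ).re ^ 2 + (stdAddChar (-(j * l)) : ℂ).im ^ 2
        = 1 := fun j => by
      have h := AddChar.norm_apply (stdAddChar (N := n)) (-(j * l))
      rw [pow_two, pow_two, ← Complex.normSq_apply, Complex.normSq_eq_norm_sq, h, one_pow]
    simp [this]
  simp only [key, ← sum_div, sum_add_distrib]
  rw [div_le_one hn, ← hxy]
  exact add_le_add (hu.sum_inner_products_le x) (hu.sum_inner_products_le y)

lemma lqNorm_nonneg {ι : Type*} [Fintype ι] (q : ℝ) (v : ι → ℂ) : 0 ≤ lqNorm q v :=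
  Real.rpow_nonneg (sum_nonneg fun _ _ => Real.rpow_nonneg (norm_nonneg _) _) _

/-- A weighted `ℓ₂` sum with weights in `[0, 1]` is controlled by the `ℓ_q` norm. -/
lemma sum_norm_sq_mul_le {ι : Type*} [Fintype ι] {q : ℝ} (hq : 2 < q) (v : ι → ℂ) (p : ι → ℝ)
    (hp0 : ∀ l, 0 ≤ p l) (hp1 : ∀ l, p l ≤ 1) :
    ∑ l, ‖v l‖ ^ 2 * p l ≤ lqNorm q v ^ 2 * (∑ l, p l) ^ ((q - 2) / q) := by
  have hconj : (q / 2).HolderConjugate (q / (q - 2)) := by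
    rw [Real.holderConjugate_iff]
    refine ⟨by linarith, ?_⟩
    have : q - 2 ≠ 0 := by linarith
    have : q ≠ 0 := by linarith
    field_simp
    ring
  have h := Real.inner_le_Lp_mul_Lq_of_nonneg univ hconj (f := fun l => ‖v l‖ ^ 2) (g := p)
    (fun _ _ => by positivity) (fun l _ => hp0 l)
  refine h.trans (mul_le_mul ?_ ?_ (Real.rpow_nonneg (sum_nonneg fun l _ =>
    Real.rpow_nonneg (hp0 l) _) _) (sq_nonneg _))
  · have : ∀ l, (‖v l‖ ^ 2) ^ (q / 2) = ‖v l‖ ^ q := fun l => by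
      rw [← Real.rpow_natCast, ← Real.rpow_mul (norm_nonneg _)]
      congr 1
      push_cast
      ring
    simp only [this]
    rw [lqNorm, ← Real.rpow_natCast, ← Real.rpow_mul (sum_nonneg fun _ _ =>
      Real.rpow_nonneg (norm_nonneg _) _)]
    apply le_of_eq
    congr 1
    push_cast
    field_simp
  · rw [one_div_div]
    refine Real.rpow_le_rpow (sum_nonneg fun l _ => Real.rpow_nonneg (hp0 l) _)
      (sum_le_sum fun l _ => ?_) (by apply div_nonneg <;> linarith)
    -- The exponent `q / (q - 2)` exceeds `1`, so raising a weight in `[0, 1]` to it only decreases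
    -- it.
    refine (Real.rpow_le_rpow_of_exponent_ge' (hp0 l) (hp1 l) zero_le_one ?_).trans_eq
      (Real.rpow_one _)
    rw [le_div_iff₀] <;> linarith

/-- Bound on the energy of the shifts of `a` in a subspace. -/
lemma sum_norm_starProjection_cyclicShift_sq_le {q : ℝ} (hq : 2 < q)
    (a : EuclideanSpace ℝ (ZMod n)) (F : Submodule ℝ (EuclideanSpace ℝ (ZMod n))) :
    ∑ i : ZMod n, ‖F.starProjection (cyclicShift i a)‖ ^ 2 ≤
      n * (lqNorm q (normalizedDFT a) ^ 2 * (Module.finrank ℝ F : ℝ) ^ ((q - 2) / q)) := by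
  let b := stdOrthonormalBasis ℝ F
  have hb : Orthonormal ℝ (fun m => (b m : EuclideanSpace ℝ (ZMod n))) :=
    b.orthonormal.comp_linearIsometry F.subtypeₗᵢ
  have h1 : ∀ x, ‖F.starProjection x‖ ^ 2 =
      ∑ m, (inner ℝ x (b m : EuclideanSpace ℝ (ZMod n))) ^ 2 := fun x => by
    rw [Submodule.starProjection_apply, ← Submodule.coe_norm, ← b.sum_sq_norm_inner_right]
    refine sum_congr rfl fun m _ => ?_
    rw [Real.norm_eq_abs, sq_abs, real_inner_comm,
      F.inner_orthogonalProjectionOnto_eq_of_mem_right]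
  -- The products of the shifts of `a` with a basis vector are, up to reindexing, the coordinates of
  -- its convolution with `a`.
  have h2 : ∑ i : ZMod n, ‖F.starProjection (cyclicShift i a)‖ ^ 2 =
      ∑ m, ∑ i, circConv a (b m : EuclideanSpace ℝ (ZMod n)) i ^ 2 := by
    simp only [h1]
    rw [sum_comm]
    refine sum_congr rfl fun m _ => Fintype.sum_equiv (Equiv.neg _) _ _ fun i => ?_
    rw [circConv_eq_inner]
    simp
  have h3 : ∑ l, ∑ m, ‖normalizedDFT (b m : EuclideanSpace ℝ (ZMod n)) l‖ ^ 2 =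
      Module.finrank ℝ F := by
    rw [sum_comm]
    simp only [sum_norm_sq_normalizedDFT, hb.1]
    simp
  rw [h2]
  simp only [sum_circConv_sq]
  rw [← mul_sum, sum_comm, ← h3]
  simp only [← mul_sum]
  refine mul_le_mul_of_nonneg_left ?_ (Nat.cast_nonneg n)
  exact sum_norm_sq_mul_le hq _ _ (fun l => sum_nonneg fun _ _ => sq_nonneg _)
    (sum_norm_sq_normalizedDFT_le_one hb)

end Fourier

/-! ### Greedy selection of separated vectors -/

section Greedy

variable {E : Type*} [NormedAddCommGroup E] [InnerProductSpace ℝ E]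

/-- Every vector of the family is at distance at least `1/2` from the span of the earlier ones. -/
def SequentiallySeparated {ι : Type*} [LT ι] (v : ι → E) : Prop :=
  ∀ j, ∀ w ∈ Submodule.span ℝ (v '' {i | i < j}), 1 / 2 ≤ ‖v j - w‖

lemma SequentiallySeparated.comp {ι κ : Type*} [Preorder ι] [Preorder κ] {v : ι → E}
    (hv : SequentiallySeparated v) {f : κ → ι} (hf : StrictMono f) :
    SequentiallySeparated (v ∘ f) := by
  intro j w hw
  refine hv (f j) w (Submodule.span_mono ?_ hw)
  rintro _ ⟨i, hi, rfl⟩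
  exact ⟨f i, hf hi, rfl⟩

lemma SequentiallySeparated.map {E' : Type*} [NormedAddCommGroup E'] [InnerProductSpace ℝ E']
    {ι : Type*} [LT ι] {v : ι → E} (hv : SequentiallySeparated v) (U : E →ₗᵢ[ℝ] E') :
    SequentiallySeparated (fun i => U (v i)) := by
  intro j w hw
  have : (fun i => U (v i)) '' {i | i < j} = U.toLinearMap '' (v '' {i | i < j}) := by
    rw [Set.image_image]; rfl
  rw [this, Submodule.span_image] at hw
  obtain ⟨w, hw, rfl⟩ := hw
  have := hv j w hw
  rwa [LinearIsometry.coe_toLinearMap, ← map_sub, U.norm_map]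

lemma SequentiallySeparated.injective {ι : Type*} [LinearOrder ι] {v : ι → E}
    (hv : SequentiallySeparated v) : Function.Injective v := by
  have key : ∀ i j, i < j → v i ≠ v j := fun i j hij h => by
    have := hv j (v i) (Submodule.subset_span ⟨i, hij, rfl⟩)
    rw [h, sub_self, norm_zero] at this
    norm_num at this
  intro i j h
  rcases lt_trichotomy i j with hij | hij | hij
  · exact (key _ _ hij h).elim
  · exact hij
  · exact (key _ _ hij h.symm).elim

/-- Greedy selection: if unit vectors have little energy in every subspace of dimension less than
`k`, then `k` of them form a sequentially separated family. -/
lemma exists_sequentiallySeparated [FiniteDimensional ℝ E] {ι : Type*} [Fintype ι] [Nonempty ι]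
    (v : ι → E) (hv : ∀ i, ‖v i‖ = 1) (k : ℕ)
    (hF : ∀ F : Submodule ℝ E, Module.finrank ℝ F < k →
      ∑ i, ‖F.starProjection (v i)‖ ^ 2 ≤ (Fintype.card ι : ℝ) / 2) :
    ∃ σ : Fin k → ι, SequentiallySeparated (v ∘ σ) := by
  induction k with
  | zero => exact ⟨Fin.elim0, fun j => j.elim0⟩
  | succ k ih =>
    obtain ⟨σ, hσ⟩ := ih fun F h => hF F (h.trans k.lt_succ_self)
    set F := Submodule.span ℝ (Set.range (v ∘ σ)) with hFdef
    have hfr : Module.finrank ℝ F < k + 1 :=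
      Nat.lt_succ_of_le ((finrank_range_le_card (R := ℝ) (v ∘ σ)).trans_eq (Fintype.card_fin k))
    obtain ⟨i, hi⟩ : ∃ i, ‖F.starProjection (v i)‖ ^ 2 ≤ 1 / 2 := by
      by_contra! h
      have := (Finset.sum_lt_sum_of_nonempty (univ_nonempty (α := ι)) fun i _ => h i).trans_le
        (hF F hfr)
      rw [sum_const, card_univ, nsmul_eq_mul] at this
      linarith
    -- By Pythagoras the squared distance to `F` is at least `1/2`, which exceeds `(1/2)²`.
    have hdist : ∀ w ∈ F, 1 / 2 ≤ ‖v i - w‖ := fun w hw => by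
      have h1 := F.norm_sq_eq_add_norm_sq_starProjection (v i)
      have h2 : ‖Fᗮ.starProjection (v i)‖ ≤ ‖v i - w‖ := by
        have : Fᗮ.starProjection (v i) = Fᗮ.starProjection (v i - w) := by
          rw [map_sub, Submodule.starProjection_orthogonal_apply_eq_zero hw, sub_zero]
        rw [this]
        exact Fᗮ.norm_starProjection_apply_le _
      rw [hv] at h1
      nlinarith [norm_nonneg (Fᗮ.starProjection (v i))]
    refine ⟨Fin.snoc σ i, fun j => ?_⟩
    refine Fin.lastCases ?_ (fun j => ?_) j
    · intro w hw
      simp only [Function.comp_apply, Fin.snoc_last]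
      refine hdist w (Submodule.span_mono ?_ hw)
      rintro _ ⟨m, hm, rfl⟩
      obtain ⟨m, rfl⟩ := Fin.exists_castSucc_eq.2 (ne_of_lt hm)
      exact ⟨m, by simp⟩
    · intro w hw
      simp only [Function.comp_apply, Fin.snoc_castSucc]
      refine hσ j w (Submodule.span_mono ?_ hw)
      rintro _ ⟨m, hm, rfl⟩
      obtain ⟨m, rfl⟩ := Fin.exists_castSucc_eq.2 (ne_of_lt (lt_of_lt_of_le hm (Fin.le_last _)))
      exact ⟨m, by simpa using hm, by simp⟩

end Greedy

/-- The diagonal of the Gram-Schmidt matrix of a sequentially separated family is at least `1/2`. -/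
lemma SequentiallySeparated.half_le_inner {k : ℕ} {F : Type*}
    [NormedAddCommGroup F] [InnerProductSpace ℝ F] [FiniteDimensional ℝ F] {w : Fin k → F} (hw : SequentiallySeparated w) (h : Module.finrank ℝ F = Fintype.card (Fin k)) (j : Fin k) :
    1 / 2 ≤ inner ℝ (InnerProductSpace.gramSchmidtOrthonormalBasis h w j) (w j) := by
  set g := InnerProductSpace.gramSchmidt ℝ w with hg
  have hmem : ∑ i ∈ Iio j, (ℝ ∙ g i).starProjection (w j) ∈
      Submodule.span ℝ (w '' {i | i < j}) := by
    have := InnerProductSpace.span_gramSchmidt_Iio ℝ w j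
    change _ ∈ Submodule.span ℝ (w '' Set.Iio j)
    rw [← this]
    refine Submodule.sum_mem _ fun i hi => ?_
    rw [Submodule.starProjection_singleton]
    exact Submodule.smul_mem _ _ (Submodule.subset_span ⟨i, Finset.mem_Iio.1 hi, rfl⟩)
  have hnorm : 1 / 2 ≤ ‖g j‖ := by
    rw [hg, InnerProductSpace.gramSchmidt_def]
    exact hw j _ hmem
  have hpos : 0 < ‖g j‖ := by linarith
  have hne : InnerProductSpace.gramSchmidtNormed ℝ w j ≠ 0 := by
    have := norm_pos_iff.1 hpos
    simp [InnerProductSpace.gramSchmidtNormed, ← hg, this]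
  have horth : ∑ i ∈ Iio j, inner ℝ (g j) ((ℝ ∙ g i).starProjection (w j)) = 0 := by
    refine sum_eq_zero fun i hi => ?_
    rw [Submodule.starProjection_singleton, inner_smul_right,
      InnerProductSpace.gramSchmidt_orthogonal ℝ w (Finset.mem_Iio.1 hi).ne', mul_zero]
  have hin : inner ℝ (g j) (w j) = ‖g j‖ ^ 2 := by
    conv_lhs => rw [InnerProductSpace.gramSchmidt_def' ℝ w j]
    rw [inner_add_right, inner_sum, ← hg, horth, add_zero, real_inner_self_eq_norm_sq]
  rw [InnerProductSpace.gramSchmidtOrthonormalBasis_apply h hne,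
    InnerProductSpace.gramSchmidtNormed, real_inner_smul_left, ← hg, hin]
  have : (‖g j‖ : ℝ)⁻¹ * ‖g j‖ ^ 2 = ‖g j‖ := by field_simp
  simpa [this] using hnorm

lemma measurableSet_forall_abs_inner_lt {k : ℕ} {F : Type*} [NormedAddCommGroup F]
    [InnerProductSpace ℝ F] [MeasurableSpace F] [BorelSpace F] (w : Fin k → F) (r : ℝ) :
    MeasurableSet {x : F | ∀ j, |inner ℝ (w j) x| < r} := by
  simp only [Set.ofPred_forall]
  refine MeasurableSet.iInter fun j => (isOpen_lt ?_ continuous_const).measurableSet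
  fun_prop

/-! ### Volumes of parallelepipeds and averaging over balls -/

section Volume

variable {k : ℕ} {F : Type*} [NormedAddCommGroup F] [InnerProductSpace ℝ F] [MeasurableSpace F]
  [BorelSpace F] [FiniteDimensional ℝ F]

lemma volume_cube (b : OrthonormalBasis (Fin k) ℝ F) {r : ℝ} (hr : 0 < r) :
    volume {x : F | ∀ i, |b.repr x i| < r} = ENNReal.ofReal ((2 * r) ^ k) := by
  have h := (PiLp.volume_preserving_ofLp (Fin k)).comp b.measurePreserving_repr
  have hs : {x : F | ∀ i, |b.repr x i| < r} =
      (WithLp.ofLp ∘ b.repr) ⁻¹' (Metric.ball (0 : Fin k → ℝ) r) := by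
    ext x
    simp [pi_norm_lt_iff hr]
  rw [hs, h.measure_preimage Metric.isOpen_ball.measurableSet.nullMeasurableSet,
    Real.volume_pi_ball _ hr, Fintype.card_fin]

/-- Volume of the parallelepiped defined by a sequentially separated family. -/
lemma SequentiallySeparated.volume_parallelepiped_le {w : Fin k → F}
    (hw : SequentiallySeparated w) (h : Module.finrank ℝ F = k) {r : ℝ} (hr : 0 < r) :
    volume {x : F | ∀ j, |inner ℝ (w j) x| < r} ≤ ENNReal.ofReal ((4 * r) ^ k) := by
  have h' : Module.finrank ℝ F = Fintype.card (Fin k) := by rw [h, Fintype.card_fin]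
  set b := InnerProductSpace.gramSchmidtOrthonormalBasis h' w with hb
  -- `T` sends `x` to its marginals along `w`, making the parallelepiped the preimage of a cube. In
  -- the Gram-Schmidt basis its determinant is the product of diagonal entries, each at least `1/2`.
  let A : Matrix (Fin k) (Fin k) ℝ := (b.toBasis.toMatrix w).transpose
  let T : F →ₗ[ℝ] F := Matrix.toLin b.toBasis b.toBasis A
  have hdet : (1 / 2 : ℝ) ^ k ≤ LinearMap.det T := by
    rw [LinearMap.det_toLin, Matrix.det_transpose, ← Module.Basis.det_apply,
      InnerProductSpace.gramSchmidtOrthonormalBasis_det]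
    calc (1 / 2 : ℝ) ^ k = ∏ _j : Fin k, (1 / 2 : ℝ) := by simp
      _ ≤ _ := prod_le_prod (fun _ _ => by norm_num) fun j _ => hw.half_le_inner h' j
  have hpos : 0 < LinearMap.det T := lt_of_lt_of_le (by positivity) hdet
  have hT : ∀ x j, b.repr (T x) j = inner ℝ (w j) x := fun x j => by
    have h1 : b.toBasis.repr (T x) j = ∑ m, A j m * b.toBasis.repr x m := by
      have := congrFun (Matrix.repr_toLin b.toBasis b.toBasis A x) j
      exact this
    rw [← OrthonormalBasis.coe_toBasis_repr_apply, h1, ← b.sum_inner_mul_inner]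
    refine sum_congr rfl fun m _ => ?_
    simp only [A, Matrix.transpose_apply, Module.Basis.toMatrix_apply,
      OrthonormalBasis.coe_toBasis_repr_apply, b.repr_apply_apply]
    rw [real_inner_comm (w j)]
  have hs : {x : F | ∀ j, |inner ℝ (w j) x| < r} = T ⁻¹' {x : F | ∀ i, |b.repr x i| < r} := by
    ext x
    simp [hT]
  rw [hs, Measure.addHaar_preimage_linearMap _ hpos.ne', volume_cube b hr,
    ← ENNReal.ofReal_mul (abs_nonneg _)]
  refine ENNReal.ofReal_le_ofReal ?_
  rw [abs_of_pos (inv_pos.2 hpos)]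
  have : (LinearMap.det T)⁻¹ ≤ 2 ^ k := by
    rw [inv_le_comm₀ hpos (by positivity)]
    simpa using hdet
  calc _ ≤ 2 ^ k * (2 * r) ^ k := by gcongr
    _ = _ := by rw [← mul_pow]; ring

/-- The ball contains a cube of half-side `r / √k`; this `√k` later cancels the one in the
small-ball assumption. -/
lemma le_volume_closedBall (h : Module.finrank ℝ F = k) (hk : 0 < k) {r : ℝ} (hr : 0 < r)
    (y : F) : ENNReal.ofReal ((2 * (r / √k)) ^ k) ≤ volume (Metric.closedBall y r) := by
  have hk' : (0 : ℝ) < k := Nat.cast_pos.2 hk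
  rw [Measure.addHaar_closedBall_center,
    ← volume_cube ((stdOrthonormalBasis ℝ F).reindex (finCongr h)) (by positivity)]
  refine measure_mono fun x hx => ?_
  set b := (stdOrthonormalBasis ℝ F).reindex (finCongr h)
  rw [mem_closedBall_zero_iff]
  refine abs_le_of_sq_le_sq' ?_ hr.le |>.2
  rw [← b.sum_sq_norm_inner_right]
  calc ∑ i, ‖inner ℝ (b i) x‖ ^ 2 ≤ ∑ _i : Fin k, (r / √k) ^ 2 := by
        refine sum_le_sum fun i _ => ?_
        rw [← b.repr_apply_apply, Real.norm_eq_abs]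
        exact pow_le_pow_left₀ (abs_nonneg _) (hx i).le 2
    _ = r ^ 2 := by
        rw [sum_const, card_univ, Fintype.card_fin, nsmul_eq_mul, div_pow,
          Real.sq_sqrt hk'.le]
        field_simp

variable {Ω : Type*} [MeasurableSpace Ω]

/-- A bound for the measure of balls of radius `ε` gives a bound for the measure of a
parallelepiped, by averaging over the centres of the balls. -/
lemma measure_parallelepiped_mul_volume_le {μ : Measure Ω} [SFinite μ] {Y : Ω → F}
    (hY : Measurable Y) {w : Fin k → F} (hw1 : ∀ j, ‖w j‖ ≤ 1) {ε : ℝ} {B : ENNReal}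
    (hB : ∀ y, μ {ω | ‖Y ω - y‖ ≤ ε} ≤ B) :
    μ {ω | ∀ j, |inner ℝ (w j) (Y ω)| < ε} * volume (Metric.closedBall (0 : F) ε) ≤
      B * volume {x : F | ∀ j, |inner ℝ (w j) x| < 2 * ε} := by
  -- The measure of `D` is computed by Fubini in both orders: slices over `ω` are balls around `Y
  -- ω`, while slices over `y` have measure at most `B` and are empty outside the doubled
  -- parallelepiped.
  set D : Set (Ω × F) := {p | (∀ j, |inner ℝ (w j) (Y p.1)| < ε) ∧ ‖Y p.1 - p.2‖ ≤ ε}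
  have hYm : Measurable fun p : Ω × F => Y p.1 := hY.comp measurable_fst
  have hP := measurableSet_forall_abs_inner_lt w (2 * ε)
  have hS : MeasurableSet {ω | ∀ j, |inner ℝ (w j) (Y ω)| < ε} :=
    hY (measurableSet_forall_abs_inner_lt w ε)
  have hD : MeasurableSet D := (hYm (measurableSet_forall_abs_inner_lt w ε)).inter
    (measurableSet_le (hYm.sub measurable_snd).norm measurable_const)
  have h1 : (μ.prod volume) D = μ {ω | ∀ j, |inner ℝ (w j) (Y ω)| < ε} *
      volume (Metric.closedBall (0 : F) ε) := by
    rw [Measure.prod_apply hD, mul_comm, ← lintegral_indicator_const hS]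
    refine lintegral_congr fun ω => ?_
    by_cases hω : ∀ j, |inner ℝ (w j) (Y ω)| < ε
    · rw [Set.indicator_of_mem (by exact hω), ← Measure.addHaar_closedBall_center volume (Y ω)]
      congr 1
      ext y
      simp [D, hω, dist_eq_norm, norm_sub_rev y]
    · rw [Set.indicator_of_notMem (by exact hω)]
      simp [D, hω]
  rw [← h1, Measure.prod_apply_symm hD, ← lintegral_indicator_const hP]
  refine lintegral_mono fun y => ?_
  by_cases hy : ∀ j, |inner ℝ (w j) y| < 2 * ε
  · rw [Set.indicator_of_mem (by exact hy)]
    exact (measure_mono fun ω hω => hω.2).trans (hB y)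
  · have : (fun ω => (ω, y)) ⁻¹' D = ∅ := by
      refine Set.eq_empty_of_forall_notMem fun ω hω => hy fun j => ?_
      have h2 : |inner ℝ (w j) (Y ω - y)| ≤ ε :=
        (abs_real_inner_le_norm _ _).trans ((mul_le_of_le_one_left (norm_nonneg _) (hw1 j)).trans
          hω.2)
      have h3 := hω.1 j
      rw [inner_sub_right] at h2
      rw [abs_lt] at h3 ⊢
      rw [abs_le] at h2
      constructor <;> linarith [h2.1, h2.2, h3.1, h3.2]
    rw [this, measure_empty]
    exact zero_le

end Volume

/-! ### Small-ball estimates for separated marginals -/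

lemma SequentiallySeparated.linearIndependent {E : Type*} [NormedAddCommGroup E]
    [InnerProductSpace ℝ E] {k : ℕ} {v : Fin k → E} (hv : SequentiallySeparated v) :
    LinearIndependent ℝ v := by
  induction k with
  | zero => exact linearIndependent_empty_type
  | succ k ih =>
    refine linearIndependent_finSucc'.2 ⟨ih (hv.comp (Fin.strictMono_castSucc)), fun h => ?_⟩
    have := hv (Fin.last k) (v (Fin.last k)) (Submodule.span_mono ?_ h)
    · rw [sub_self, norm_zero] at this
      norm_num at this
    · rintro _ ⟨i, rfl⟩
      exact ⟨i.castSucc, Fin.castSucc_lt_last i, rfl⟩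

/-- Joint small-ball estimate for the marginals in a sequentially separated family of
directions. -/
lemma SmallBallAssumption.measure_forall_abs_inner_lt_le {ι Ω : Type*} [Fintype ι]
    [MeasurableSpace Ω] {μ : Measure Ω} [IsProbabilityMeasure μ] {ξ : Ω → EuclideanSpace ℝ ι}
    {L : ℝ} (hL : 0 ≤ L) (hξ : Measurable ξ) (hsba : SmallBallAssumption μ ξ L) {k : ℕ}
    (hk : 0 < k) (hkn : k < Fintype.card ι) {v : Fin k → EuclideanSpace ℝ ι}
    (hv : SequentiallySeparated v) (hv1 : ∀ j, ‖v j‖ ≤ 1) {ε : ℝ} (hε : 0 < ε) :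
    μ.real {ω | ∀ j, |inner ℝ (v j) (ξ ω)| < ε} ≤ (4 * L * ε) ^ k := by
  have hk' : (0 : ℝ) < k := Nat.cast_pos.2 hk
  set F := Submodule.span ℝ (Set.range v)
  have hF : Module.finrank ℝ F = k := by
    rw [finrank_span_eq_card hv.linearIndependent, Fintype.card_fin]
  let w : Fin k → F := fun j => ⟨v j, Submodule.subset_span ⟨j, rfl⟩⟩
  have hw : SequentiallySeparated w := by
    intro j x hx
    have hx' : (x : EuclideanSpace ℝ ι) ∈ Submodule.span ℝ (v '' {i | i < j}) := by
      have := Submodule.mem_map_of_mem (f := F.subtype) hx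
      rw [Submodule.map_span, Set.image_image] at this
      exact this
    exact hv j x hx'
  let Y : Ω → F := fun ω => F.orthogonalProjectionOnto (ξ ω)
  have hY : Measurable Y := F.orthogonalProjectionOnto.continuous.measurable.comp hξ
  have hwY : ∀ j ω, inner ℝ (w j) (Y ω) = inner ℝ (v j) (ξ ω) := fun j ω => by
    rw [real_inner_comm, real_inner_comm (ξ ω)]
    exact F.inner_orthogonalProjectionOnto_eq_of_mem_right (w j) (ξ ω)
  have hB : ∀ y, μ {ω | ‖Y ω - y‖ ≤ ε} ≤ ENNReal.ofReal ((L * (ε / √k)) ^ k) := fun y => by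
    rw [← ofReal_measureReal]
    refine ENNReal.ofReal_le_ofReal ?_
    have := hsba k hk hkn F hF y (ε / √k) (by positivity)
    rw [div_mul_cancel₀ ε (by positivity)] at this
    exact this
  have main := measure_parallelepiped_mul_volume_le hY (w := w) hv1 hB
  simp only [hwY] at main
  -- The ratio `(L ε / √k)^k (8 ε)^k / (2 ε / √k)^k` equals `(4 L ε)^k`.
  have h1 := (mul_le_mul_right (le_volume_closedBall hF hk hε 0) _).trans (main.trans
    (mul_le_mul_right (hw.volume_parallelepiped_le hF (by positivity : 0 < 2 * ε)) _))
  rw [← ofReal_measureReal, ← ENNReal.ofReal_mul measureReal_nonneg, ← ENNReal.ofReal_mul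
    (by positivity), ENNReal.ofReal_le_ofReal_iff (by positivity)] at h1
  refine le_of_mul_le_mul_right (h1.trans_eq ?_) (by positivity : 0 < (2 * (ε / √k)) ^ k)
  rw [← mul_pow, ← mul_pow]
  congr 1
  ring

/-- With high probability, more than half of the marginals in a sequentially separated family of
directions are not small. -/
lemma SmallBallAssumption.measure_half_le_card_small_le {ι Ω : Type*} [Fintype ι]
    [MeasurableSpace Ω] {μ : Measure Ω} [IsProbabilityMeasure μ] {ξ : Ω → EuclideanSpace ℝ ι}
    {L : ℝ} (hL : 0 ≤ L) (hξ : Measurable ξ) (hsba : SmallBallAssumption μ ξ L) {k : ℕ}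
    (hk : 0 < k) (hkn : (k + 1) / 2 < Fintype.card ι) {v : Fin k → EuclideanSpace ℝ ι}
    (hv : SequentiallySeparated v) (hv1 : ∀ j, ‖v j‖ ≤ 1) {ε : ℝ} (hε : 0 < ε) :
    μ.real {ω | (k + 1) / 2 ≤ (univ.filter fun j => |inner ℝ (v j) (ξ ω)| < ε).card} ≤
      (16 * L * ε) ^ ((k + 1) / 2) := by
  set k' := (k + 1) / 2 with hk'
  have hsub : {ω | k' ≤ (univ.filter fun j => |inner ℝ (v j) (ξ ω)| < ε).card} ⊆
      ⋃ S ∈ powersetCard k' (univ : Finset (Fin k)), {ω | ∀ j ∈ S, |inner ℝ (v j) (ξ ω)| < ε} := by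
    intro ω hω
    obtain ⟨S, hS, hcard⟩ := exists_subset_card_eq hω
    simp only [Set.mem_iUnion]
    exact ⟨S, mem_powersetCard.2 ⟨subset_univ _, hcard⟩, fun j hj => (mem_filter.1 (hS hj)).2⟩
  have hS : ∀ S ∈ powersetCard k' (univ : Finset (Fin k)),
      μ.real {ω | ∀ j ∈ S, |inner ℝ (v j) (ξ ω)| < ε} ≤ (4 * L * ε) ^ k' := by
    intro S hS
    have hcard := (mem_powersetCard.1 hS).2
    refine (measureReal_mono ?_).trans (hsba.measure_forall_abs_inner_lt_le hL hξ
      (by omega : 0 < k') hkn (hv.comp (S.orderEmbOfFin hcard).strictMono) (fun j => hv1 _) hε)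
    intro ω hω j
    exact hω _ (S.orderEmbOfFin_mem hcard j)
  calc _ ≤ μ.real (⋃ S ∈ powersetCard k' (univ : Finset (Fin k)),
        {ω | ∀ j ∈ S, |inner ℝ (v j) (ξ ω)| < ε}) := measureReal_mono hsub (measure_ne_top _ _)
    _ ≤ ∑ S ∈ powersetCard k' (univ : Finset (Fin k)),
        μ.real {ω | ∀ j ∈ S, |inner ℝ (v j) (ξ ω)| < ε} := measureReal_biUnion_finset_le _ _
    _ ≤ (powersetCard k' (univ : Finset (Fin k))).card * (4 * L * ε) ^ k' := by
        rw [← nsmul_eq_mul]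
        exact sum_le_card_nsmul _ _ _ hS
    _ ≤ 4 ^ k' * (4 * L * ε) ^ k' := by
        refine mul_le_mul_of_nonneg_right ?_ (by positivity)
        -- As `k' = ⌈k/2⌉`, the number of half-blocks is at most `2^k ≤ 4^k'`, which is absorbed
        -- into the base.
        have h1 : (powersetCard k' (univ : Finset (Fin k))).card ≤ 2 ^ k := by
          rw [card_powersetCard, card_univ, Fintype.card_fin]
          exact Nat.choose_le_two_pow _ _
        have h2 : 2 ^ k ≤ 4 ^ k' := by
          rw [show 4 = 2 ^ 2 by norm_num, ← pow_mul]
          exact Nat.pow_le_pow_right (by norm_num) (by omega)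
        exact_mod_cast h1.trans h2
    _ = _ := by
        rw [← mul_pow]
        ring

/-- Markov's inequality for the number of events that occur. -/
lemma measure_card_le_two_mul_card_le {ι Ω : Type*} [Fintype ι] [Nonempty ι]
    [MeasurableSpace Ω] {μ : Measure Ω} [IsProbabilityMeasure μ] (B : ι → Set Ω)
    (hB : ∀ t, MeasurableSet (B t)) {p : ℝ} (hp : ∀ t, μ.real (B t) ≤ p)
    [∀ ω, DecidablePred fun t => ω ∈ B t] :
    μ.real {ω | Fintype.card ι ≤ 2 * (univ.filter fun t => ω ∈ B t).card} ≤ 2 * p := by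
  have hι : (0 : ℝ) < Fintype.card ι := Nat.cast_pos.2 Fintype.card_pos
  let f : Ω → ℝ := fun ω => ∑ t, (B t).indicator 1 ω
  have hf : ∀ ω, f ω = (univ.filter fun t => ω ∈ B t).card := fun ω => by
    simp [f, Set.indicator_apply]
  have hint : ∀ t ∈ univ, Integrable ((B t).indicator (1 : Ω → ℝ)) μ := fun t _ =>
    (integrable_const (1 : ℝ)).indicator (hB t)
  have h := mul_meas_ge_le_integral_of_nonneg (μ := μ) (f := f)
    (ae_of_all _ fun ω => by simp only [hf]; positivity) (integrable_finsetSum _ hint)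
    (Fintype.card ι / 2)
  have h2 : ∫ ω, f ω ∂μ ≤ Fintype.card ι * p := by
    rw [integral_finsetSum _ hint]
    calc ∑ t, ∫ ω, (B t).indicator (1 : Ω → ℝ) ω ∂μ = ∑ t, μ.real (B t) :=
          sum_congr rfl fun t _ => integral_indicator_one (hB t)
      _ ≤ ∑ _t : ι, p := sum_le_sum fun t _ => hp t
      _ = _ := by simp
  have h3 : {ω | Fintype.card ι ≤ 2 * (univ.filter fun t => ω ∈ B t).card} =
      {ω | (Fintype.card ι : ℝ) / 2 ≤ f ω} := by
    ext ω
    simp only [Set.mem_ofPred_eq, hf]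
    rw [div_le_iff₀ two_pos, mul_comm]
    exact_mod_cast Iff.rfl
  rw [h3]
  have := h.trans h2
  rw [div_mul_eq_mul_div, mul_div_assoc] at this
  have := le_of_mul_le_mul_left this hι
  linarith

/-- If most translates of a block meet `P` in at least half of their points, then `P` contains at
least a quarter of the group. -/
lemma card_le_four_mul_card_filter {G : Type*} [AddCommGroup G] [Fintype G] {k : ℕ} (hk : 0 < k)
    (σ : Fin k → G) (P : G → Prop) [DecidablePred P]
    (h : 2 * (univ.filter fun t => (k + 1) / 2 ≤ (univ.filter fun j => ¬ P (σ j + t)).card).card <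
      Fintype.card G) :
    Fintype.card G ≤ 4 * (univ.filter P).card := by
  classical
  -- Each point of `G` equals `σ j + t` for exactly `k` pairs `(j, t)`.
  have hsum : ∑ t, (univ.filter fun j => P (σ j + t)).card = k * (univ.filter P).card := by
    simp only [card_filter]
    rw [sum_comm]
    have : ∀ j, ∑ t, (if P (σ j + t) then 1 else 0) = ∑ i, if P i then 1 else 0 := fun j =>
      Fintype.sum_equiv (Equiv.addLeft (σ j)) _ _ fun t => rfl
    simp [this]
  set bad := univ.filter fun t => (k + 1) / 2 ≤ (univ.filter fun j => ¬ P (σ j + t)).card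
  have hgood : ∀ t ∈ badᶜ, k ≤ 2 * (univ.filter fun j => P (σ j + t)).card := fun t ht => by
    have h1 : (univ.filter fun j => ¬ P (σ j + t)).card < (k + 1) / 2 := by
      simpa [bad] using ht
    have h2 := card_filter_add_card_filter_not (s := (univ : Finset (Fin k)))
      (fun j => P (σ j + t))
    rw [card_univ, Fintype.card_fin] at h2
    omega
  have h3 : badᶜ.card * k ≤ 2 * (k * (univ.filter P).card) := by
    rw [← hsum, mul_sum]
    calc badᶜ.card * k = ∑ t ∈ badᶜ, k := by simp
      _ ≤ ∑ t ∈ badᶜ, 2 * (univ.filter fun j => P (σ j + t)).card := sum_le_sum hgood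
      _ ≤ _ := sum_le_sum_of_subset (subset_univ _)
  have h4 : badᶜ.card ≤ 2 * (univ.filter P).card := by
    refine Nat.le_of_mul_le_mul_left ?_ hk
    linarith
  have h5 := card_add_card_compl bad
  omega

/-! ### Translating a separated block of shifts -/

section Shift

variable {n : ℕ}

lemma norm_cyclicShift [NeZero n] (i : ZMod n) (x : EuclideanSpace ℝ (ZMod n)) :
    ‖cyclicShift i x‖ = ‖x‖ := by
  simp only [EuclideanSpace.norm_eq, cyclicShift]
  congr 1
  exact Fintype.sum_equiv (Equiv.subRight i) _ _ fun j => rfl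

/-- The cyclic shift as a linear isometry. -/
def cyclicShiftₗᵢ [NeZero n] (i : ZMod n) :
    EuclideanSpace ℝ (ZMod n) →ₗᵢ[ℝ] EuclideanSpace ℝ (ZMod n) where
  toFun := cyclicShift i
  map_add' _ _ := rfl
  map_smul' _ _ := rfl
  norm_map' := norm_cyclicShift i

lemma cyclicShift_add (s t : ZMod n) (x : EuclideanSpace ℝ (ZMod n)) :
    cyclicShift (s + t) x = cyclicShift t (cyclicShift s x) := by
  ext j
  exact congrArg x.ofLp (by ring : j - (s + t) = j - t - s)

end Shift

/-- If some `k` shifts of `a` are sequentially separated, then with high probability a quarter of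
the coordinates of `a ⊛ ξ` are not small. -/
lemma SmallBallAssumption.measure_four_mul_card_lt_le {n : ℕ} [NeZero n] (hn : 2 ≤ n) {Ω : Type*}
    [MeasurableSpace Ω] {μ : Measure Ω} [IsProbabilityMeasure μ]
    {ξ : Ω → EuclideanSpace ℝ (ZMod n)} {L : ℝ} (hL : 0 ≤ L) (hξ : Measurable ξ)
    (hsba : SmallBallAssumption μ ξ L) {a : EuclideanSpace ℝ (ZMod n)} (ha : ‖a‖ = 1) {k : ℕ}
    (hk : 0 < k) (σ : Fin k → ZMod n)
    (hσ : SequentiallySeparated ((fun i => cyclicShift (-i) a) ∘ σ)) {ε : ℝ} (hε : 0 < ε) :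
    μ.real {ω | 4 * (univ.filter fun i => ε ≤ |circConv a (ξ ω) i|).card < n} ≤
      (32 * L * ε) ^ ((k + 1) / 2) := by
  classical
  have hkn : k ≤ n := by
    have := Fintype.card_le_of_injective σ (Function.Injective.of_comp hσ.injective)
    simpa [ZMod.card] using this
  let v : ZMod n → Fin k → EuclideanSpace ℝ (ZMod n) := fun t j =>
    cyclicShiftₗᵢ (-t) (cyclicShift (-σ j) a)
  have hinner : ∀ t j ω, inner ℝ (v t j) (ξ ω) = circConv a (ξ ω) (σ j + t) := fun t j ω => by
    rw [circConv_eq_inner, neg_add, cyclicShift_add]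
    rfl
  let B : ZMod n → Set Ω := fun t =>
    {ω | (k + 1) / 2 ≤ (univ.filter fun j => |inner ℝ (v t j) (ξ ω)| < ε).card}
  have hBm : ∀ t, MeasurableSet (B t) := fun t => by
    simp only [B, card_filter]
    refine measurableSet_le measurable_const (Finset.measurable_fun_sum _ fun j _ => ?_)
    refine Measurable.ite (measurableSet_lt ?_ measurable_const) measurable_const measurable_const
    exact (measurable_const.inner hξ).abs
  -- The block may have `n` elements, but only half-blocks are projected onto; `⌈k/2⌉ < n` holds
  -- because `k ≤ n` and `n ≥ 2`.
  have hB : ∀ t, μ.real (B t) ≤ (16 * L * ε) ^ ((k + 1) / 2) := fun t =>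
    hsba.measure_half_le_card_small_le hL hξ hk (by rw [ZMod.card]; omega)
      (hσ.map (cyclicShiftₗᵢ (-t)))
      (fun j => by rw [LinearIsometry.norm_map]; exact (norm_cyclicShift _ _).trans_le ha.le) hε
  have hsub : {ω | 4 * (univ.filter fun i => ε ≤ |circConv a (ξ ω) i|).card < n} ⊆
      {ω | Fintype.card (ZMod n) ≤ 2 * (univ.filter fun t => ω ∈ B t).card} := by
    intro ω hω
    by_contra hcon
    have := card_le_four_mul_card_filter hk σ (fun i => ε ≤ |circConv a (ξ ω) i|)
      (by
        rw [Set.mem_ofPred_eq, not_le] at hcon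
        simpa only [B, hinner, not_le, Set.mem_ofPred_eq] using hcon)
    rw [ZMod.card] at this
    exact absurd hω (not_lt.2 this)
  refine (measureReal_mono hsub).trans ((measure_card_le_two_mul_card_le B hBm hB).trans ?_)
  -- The exponent is at least `1`, so the factor `2` from Markov's inequality fits into the base.
  have h2 : (2 : ℝ) ≤ 2 ^ ((k + 1) / 2) := by
    simpa using pow_le_pow_right₀ (one_le_two (α := ℝ)) (by omega : 1 ≤ (k + 1) / 2)
  calc 2 * (16 * L * ε) ^ ((k + 1) / 2) ≤ 2 ^ ((k + 1) / 2) * (16 * L * ε) ^ ((k + 1) / 2) :=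
        mul_le_mul_of_nonneg_right h2 (by positivity)
    _ = _ := by
        rw [← mul_pow]
        ring

/-! ### Chernoff's bound and independence of the selectors -/

section Selectors

variable {ι Ω : Type*} [MeasurableSpace Ω] {μ : Measure Ω} {δ : ℝ} {sel : ι → Ω → ℝ}

lemma IsSelectorFamily.mean_nonneg [Nonempty ι] (h : IsSelectorFamily μ δ sel) : 0 ≤ δ := by
  rw [← h.mean_eq (Classical.arbitrary ι)]
  refine integral_nonneg fun ω => ?_
  rcases h.zero_or_one (Classical.arbitrary ι) ω with h | h <;> simp [h]

lemma IsSelectorFamily.integrable [IsFiniteMeasure μ] (h : IsSelectorFamily μ δ sel) (i : ι) :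
    Integrable (sel i) μ := by
  refine Integrable.of_bound (h.measurable i).aestronglyMeasurable 1 (ae_of_all _ fun ω => ?_)
  rcases h.zero_or_one i ω with h | h <;> simp [h]

/-- On `{0, 1}` the function `exp (-x)` is affine, so the mean determines the transform. -/
lemma IsSelectorFamily.mgf_neg_one_le [IsProbabilityMeasure μ] (h : IsSelectorFamily μ δ sel)
    (hδ : 0 ≤ δ) (i : ι) : mgf (sel i) μ (-1) ≤ Real.exp (-(δ / 2)) := by
  have h1 : ∀ ω, Real.exp (-1 * sel i ω) = 1 - (1 - Real.exp (-1)) * sel i ω := fun ω => by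
    rcases h.zero_or_one i ω with h | h <;> simp [h]
  have h2 : mgf (sel i) μ (-1) = 1 - (1 - Real.exp (-1)) * δ := by
    simp only [mgf, h1]
    rw [integral_sub (integrable_const _) ((h.integrable i).const_mul _), integral_const_mul,
      h.mean_eq]
    simp
  have h3 : Real.exp (-1) ≤ 1 / 2 := by
    have := Real.exp_neg_one_lt_half
    linarith
  have h4 := Real.add_one_le_exp (-(δ / 2))
  rw [h2]
  nlinarith

/-- Chernoff's bound for the lower tail of a sum of selectors. -/
lemma IsSelectorFamily.measure_sum_le_le [IsProbabilityMeasure μ] (h : IsSelectorFamily μ δ sel)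
    (hδ : 0 ≤ δ) (A : Finset ι) (c : ℝ) :
    μ.real {ω | ∑ i ∈ A, sel i ω ≤ c} ≤ Real.exp (c - δ / 2 * A.card) := by
  have hm : Measurable (∑ i ∈ A, sel i) := by
    rw [Finset.sum_fn]
    exact Finset.measurable_fun_sum _ fun i _ => h.measurable i
  have hint : Integrable (fun ω => Real.exp (-1 * (∑ i ∈ A, sel i) ω)) μ := by
    refine Integrable.of_bound (by fun_prop) 1 (ae_of_all _ fun ω => ?_)
    have : 0 ≤ (∑ i ∈ A, sel i) ω := by
      rw [Finset.sum_apply]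
      refine sum_nonneg fun i _ => ?_
      rcases h.zero_or_one i ω with h | h <;> simp [h]
    rw [Real.norm_eq_abs, Real.abs_exp, Real.exp_le_one_iff]
    linarith
  have key := measure_le_le_exp_mul_mgf (μ := μ) c (by norm_num : (-1 : ℝ) ≤ 0) hint
  simp only [Finset.sum_apply] at key
  refine key.trans ?_
  rw [h.indep.mgf_sum h.measurable]
  calc Real.exp (- -1 * c) * ∏ i ∈ A, mgf (sel i) μ (-1)
      ≤ Real.exp (- -1 * c) * ∏ _i ∈ A, Real.exp (-(δ / 2)) := by
        refine mul_le_mul_of_nonneg_left ?_ (Real.exp_pos _).le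
        exact prod_le_prod (fun i _ => mgf_nonneg) fun i _ => h.mgf_neg_one_le hδ i
    _ = _ := by
        rw [prod_const, ← Real.exp_nat_mul, ← Real.exp_add]
        congr 1
        ring

/-- A uniform bound for the events attached to fixed sets carries over to an independent random
set. -/
lemma measure_and_le_of_indepFun [Fintype ι] [IsProbabilityMeasure μ] {E G : Type*}
    [MeasurableSpace E] [MeasurableSpace G] {X : Ω → E} {Y : Ω → G} (hX : Measurable X)
    (hXY : IndepFun X Y μ) (J : E → Finset ι) (hJ : ∀ A, MeasurableSet {x | J x = A})
    (p : Finset ι → Prop) (D : Finset ι → Set G) (hD : ∀ A, MeasurableSet (D A)) {β : ℝ}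
    (hβ0 : 0 ≤ β) (hβ : ∀ A, p A → μ.real (Y ⁻¹' D A) ≤ β) :
    μ.real {ω | p (J (X ω)) ∧ Y ω ∈ D (J (X ω))} ≤ β := by
  classical
  have hsub : {ω | p (J (X ω)) ∧ Y ω ∈ D (J (X ω))} ⊆
      ⋃ A ∈ univ.filter p, X ⁻¹' {x | J x = A} ∩ Y ⁻¹' D A := fun ω hω => by
    simp only [Set.mem_iUnion]
    exact ⟨J (X ω), by simpa using hω.1, rfl, hω.2⟩
  have hdisj : ∑ A, μ.real (X ⁻¹' {x | J x = A}) = 1 := by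
    rw [← measureReal_iUnion_fintype ?_ fun A => hX (hJ A)]
    · have : ⋃ A, X ⁻¹' {x | J x = A} = Set.univ := by
        refine Set.eq_univ_of_forall fun ω => Set.mem_iUnion.2 ⟨J (X ω), rfl⟩
      rw [this, probReal_univ]
    · intro A B hAB
      refine Set.disjoint_left.2 fun ω hA hB => hAB ?_
      exact (hA : J (X ω) = A).symm.trans hB
  calc _ ≤ μ.real (⋃ A ∈ univ.filter p, X ⁻¹' {x | J x = A} ∩ Y ⁻¹' D A) :=
        measureReal_mono hsub (measure_ne_top _ _)
    _ ≤ ∑ A ∈ univ.filter p, μ.real (X ⁻¹' {x | J x = A} ∩ Y ⁻¹' D A) :=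
        measureReal_biUnion_finset_le _ _
    _ = ∑ A ∈ univ.filter p, μ.real (X ⁻¹' {x | J x = A}) * μ.real (Y ⁻¹' D A) := by
        refine sum_congr rfl fun A _ => ?_
        simp only [Measure.real]
        rw [hXY.measure_inter_preimage_eq_mul _ _ (hJ A) (hD A), ENNReal.toReal_mul]
    _ ≤ ∑ A ∈ univ.filter p, μ.real (X ⁻¹' {x | J x = A}) * β :=
        sum_le_sum fun A hA => mul_le_mul_of_nonneg_left (hβ A (mem_filter.1 hA).2)
          measureReal_nonneg
    _ ≤ ∑ A, μ.real (X ⁻¹' {x | J x = A}) * β :=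
        sum_le_sum_of_subset_of_nonneg (subset_univ _) fun A _ _ =>
          mul_nonneg measureReal_nonneg hβ0
    _ = β := by rw [← sum_mul, hdisj, one_mul]

/-- If a random set is independent of the selectors and large, then a proportion `δ` of it is
selected. -/
lemma IsSelectorFamily.measure_card_and_sum_le_le [Fintype ι] [Nonempty ι]
    [IsProbabilityMeasure μ] (h : IsSelectorFamily μ δ sel) {E : Type*} [MeasurableSpace E]
    {X : Ω → E} (hX : Measurable X) (hXY : IndepFun X (fun ω i => sel i ω) μ)
    (J : E → Finset ι) (hJ : ∀ A, MeasurableSet {x | J x = A}) :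
    μ.real {ω | Fintype.card ι ≤ 4 * (J (X ω)).card ∧
      ∑ i ∈ J (X ω), sel i ω ≤ δ * Fintype.card ι / 16} ≤
      Real.exp (-(1 / 16 * δ * Fintype.card ι)) := by
  refine measure_and_le_of_indepFun hX hXY J hJ (fun A => Fintype.card ι ≤ 4 * A.card)
    (fun A => {y | ∑ i ∈ A, y i ≤ δ * Fintype.card ι / 16}) (fun A => ?_) (Real.exp_pos _).le
    fun A hA => ?_
  · exact measurableSet_le (Finset.measurable_fun_sum _ fun i _ => measurable_pi_apply i)
      measurable_const
  -- With `N = Fintype.card ι` and `|A| ≥ N/4`, the exponent is at most `δN/16 - δN/8 = -δN/16`.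
  · refine (h.measure_sum_le_le h.mean_nonneg A _).trans (Real.exp_le_exp.2 ?_)
    have hA' : (Fintype.card ι : ℝ) ≤ 4 * A.card := by exact_mod_cast hA
    have := mul_le_mul_of_nonneg_left hA' h.mean_nonneg
    linarith

end Selectors

/-! ### Combining the estimates -/

lemma SmallBallAssumption.nonneg {ι Ω : Type*} [Fintype ι] [MeasurableSpace Ω] {μ : Measure Ω}
    {ξ : Ω → EuclideanSpace ℝ ι} {L : ℝ} (h : SmallBallAssumption μ ξ L)
    (hι : 1 < Fintype.card ι) : 0 ≤ L := by
  classical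
  have : Nonempty ι := Fintype.card_pos_iff.1 (by omega)
  have hne : EuclideanSpace.single (Classical.arbitrary ι) (1 : ℝ) ≠ 0 := by simp
  have := h 1 le_rfl hι _ (finrank_span_singleton hne) 0 1 one_pos
  simpa using measureReal_nonneg.trans this

lemma measurable_circConv {n : ℕ} [NeZero n] (a : EuclideanSpace ℝ (ZMod n)) (i : ZMod n) :
    Measurable fun x => circConv a x i := by
  simp only [circConv_eq_inner]
  exact measurable_const.inner measurable_id

/-- If the norm vanished, the Hölder bound with all weights `1` would force `‖a‖ = 0`. -/
lemma lqNorm_normalizedDFT_pos {n : ℕ} [NeZero n] {q : ℝ} (hq : 2 < q)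
    {a : EuclideanSpace ℝ (ZMod n)} (ha : ‖a‖ = 1) : 0 < lqNorm q (normalizedDFT a) := by
  refine (lqNorm_nonneg _ _).lt_of_ne' fun h => ?_
  have := sum_norm_sq_mul_le hq (normalizedDFT a) (fun _ => 1) (fun _ => zero_le_one)
    fun _ => le_rfl
  rw [h] at this
  simp only [mul_one, sum_norm_sq_normalizedDFT, ha] at this
  norm_num at this

/-- Many shifts of `a` are sequentially separated. -/
lemma exists_sequentiallySeparated_cyclicShift {n : ℕ} [NeZero n] {q : ℝ} (hq : 2 < q)
    {a : EuclideanSpace ℝ (ZMod n)} (ha : ‖a‖ = 1) {k : ℕ}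
    (hk : k ≤ (1 / 2) ^ (q / (q - 2)) / lqNorm q (normalizedDFT a) ^ (2 * q / (q - 2))) :
    ∃ σ : Fin (k + 1) → ZMod n,
      SequentiallySeparated ((fun i => cyclicShift (-i) a) ∘ σ) := by
  refine exists_sequentiallySeparated _ (fun i => (norm_cyclicShift _ _).trans ha) _
    fun F hF => ?_
  set Q := lqNorm q (normalizedDFT a)
  have hQ : 0 < Q := lqNorm_normalizedDFT_pos hq ha
  have hq2 : q - 2 ≠ 0 := by linarith
  have hq0 : q ≠ 0 := by linarith
  have h1 : (Module.finrank ℝ F : ℝ) ^ ((q - 2) / q) ≤ 1 / 2 / Q ^ 2 := by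
    have hd : (Module.finrank ℝ F : ℝ) ≤ k := by exact_mod_cast Nat.le_of_lt_succ hF
    refine (Real.rpow_le_rpow (Nat.cast_nonneg _) (hd.trans hk)
      (by apply div_nonneg <;> linarith)).trans_eq ?_
    rw [Real.div_rpow (by positivity) (by positivity), ← Real.rpow_mul (by norm_num),
      ← Real.rpow_mul hQ.le, ← Real.rpow_natCast]
    congr 1
    · rw [div_mul_div_cancel₀ hq2, div_self hq0, Real.rpow_one]
    · congr 1
      push_cast
      field_simp
  have h2 : ∑ i : ZMod n, ‖F.starProjection (cyclicShift (-i) a)‖ ^ 2 =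
      ∑ i : ZMod n, ‖F.starProjection (cyclicShift i a)‖ ^ 2 :=
    Fintype.sum_equiv (Equiv.neg _) _ _ fun i => rfl
  rw [h2, ZMod.card]
  refine (sum_norm_starProjection_cyclicShift_sq_le hq a F).trans ?_
  rw [div_eq_mul_one_div (n : ℝ)]
  refine mul_le_mul_of_nonneg_left ?_ (Nat.cast_nonneg n)
  rw [le_div_iff₀ (by positivity)] at h1
  linarith

end SubsampledConvolution

end

theorem theorem1p3 :
    ∃ c₃ > (0 : ℝ), ∃ c₄ > (0 : ℝ), ∃ c₅ > (0 : ℝ),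
      ∀ q : ℝ, 2 < q →
        ∃ c₀ > (0 : ℝ), ∃ c₁ > (0 : ℝ), ∃ c₂ > (0 : ℝ),
          ∀ (n : ℕ) [NeZero n], 2 ≤ n →
          ∀ (Ω : Type*) [MeasurableSpace Ω] (μ : Measure Ω) [IsProbabilityMeasure μ]
            (ξ : Ω → EuclideanSpace ℝ (ZMod n)) (L : ℝ),
            Measurable ξ → SubsampledConvolution.SmallBallAssumption μ ξ L →
          ∀ (δ : ℝ) (sel : ZMod n → Ω → ℝ),
            SubsampledConvolution.IsSelectorFamily μ δ sel →
            IndepFun ξ (fun ω i => sel i ω) μ →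
          ∀ (s : ℕ) (a : EuclideanSpace ℝ (ZMod n)),
            ‖a‖ = 1 → SubsampledConvolution.IsSparse s a →
            (s : ℝ) ≤ c₀ * n / Real.log n →
          ∀ ε : ℝ, 0 < ε → ε < 1 →
            1 - (c₁ * L * ε) ^
                  (c₂ / SubsampledConvolution.lqNorm q (SubsampledConvolution.normalizedDFT a)
                    ^ (2 * q / (q - 2)))
                - Real.exp (-(c₃ * δ * n))
              ≤ μ.real {ω |
                  c₄ * ε ^ 2 * δ * n ≤
                    ∑ i ∈ SubsampledConvolution.selectedSet sel ω,
                      (SubsampledConvolution.circConv a (ξ ω)) i ^ 2 ∧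
                  c₅ * δ * n ≤
                    (((SubsampledConvolution.selectedSet sel ω).filter
                      (fun i => ε ≤ |(SubsampledConvolution.circConv a (ξ ω)) i|)).card : ℝ)} := by
  refine ⟨1 / 16, by norm_num, 1 / 16, by norm_num, 1 / 16, by norm_num, fun q hq => ?_⟩
  refine ⟨1, one_pos, 32, by norm_num, (1 / 2) ^ (q / (q - 2)) / 2, by positivity, ?_⟩
  intro n _ hn Ω _ μ _ ξ L hξ hsba δ sel hsel hind s a ha _ _ ε hε _
  have hL : 0 ≤ L := hsba.nonneg (by rw [ZMod.card]; omega)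
  have hQ := SubsampledConvolution.lqNorm_normalizedDFT_pos hq ha
  set Q := SubsampledConvolution.lqNorm q (SubsampledConvolution.normalizedDFT a)
  set M := Q ^ (2 * q / (q - 2))
  have hM : 0 < M := Real.rpow_pos_of_pos hQ _
  set θ : ℝ := (1 / 2) ^ (q / (q - 2))
  have hθ : 0 < θ := by positivity
  -- If the base exceeds `1`, the claimed lower bound is negative.
  rcases lt_or_ge 1 (32 * L * ε) with hbig | hsmall
  · have h1 : 1 ≤ (32 * L * ε) ^ (θ / 2 / M) := Real.one_le_rpow hbig.le (by positivity)
    have h2 := Real.exp_pos (-(1 / 16 * δ * n))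
    refine le_trans ?_ measureReal_nonneg
    linarith
  obtain ⟨k, hk⟩ : ∃ k, k = ⌊θ / M⌋₊ := ⟨_, rfl⟩
  have hkle : k ≤ θ / M := hk ▸ Nat.floor_le (by positivity)
  have hklt : θ / M < k + 1 := hk ▸ Nat.lt_floor_add_one _
  obtain ⟨σ, hσ⟩ := SubsampledConvolution.exists_sequentiallySeparated_cyclicShift hq ha hkle
  -- The block has `k + 1` shifts, so the exponent is `⌈(k+1)/2⌉`; it is positive even when `k = 0`,
  -- and `k + 1 > θ / M` makes it at least half of `θ / M`.
  have hexp : θ / 2 / M ≤ ((k + 1 + 1) / 2 : ℕ) := by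
    have h2 : ((k + 1 : ℕ) : ℝ) ≤ (2 * ((k + 1 + 1) / 2) : ℕ) := Nat.cast_le.2 (by omega)
    push_cast at h2
    rw [div_right_comm]
    linarith
  let J : EuclideanSpace ℝ (ZMod n) → Finset (ZMod n) := fun x =>
    Finset.univ.filter fun i => ε ≤ |SubsampledConvolution.circConv a x i|
  have hJ : ∀ A, MeasurableSet {x | J x = A} := fun A => by
    simp only [J, Finset.ext_iff, Finset.mem_filter_univ, Set.ofPred_forall]
    refine MeasurableSet.iInter fun i => ?_
    exact MeasurableSet.iff (measurableSet_le measurable_const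
      (SubsampledConvolution.measurable_circConv a i).abs) (MeasurableSet.const _)
  have hB1 := hsba.measure_four_mul_card_lt_le hn hL hξ ha k.succ_pos σ hσ hε
  have hB2 := hsel.measure_card_and_sum_le_le hξ hind J hJ
  rw [ZMod.card] at hB2
  have hB1' := hB1.trans_eq (Real.rpow_natCast _ _).symm |>.trans
    (Real.rpow_le_rpow_of_exponent_ge' (by positivity) hsmall (by positivity) hexp)
  set B1 : Set Ω := {ω | 4 * (J (ξ ω)).card < n}
  set B2 : Set Ω := {ω | n ≤ 4 * (J (ξ ω)).card ∧ ∑ i ∈ J (ξ ω), sel i ω ≤ δ * n / 16}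
  set good : Set Ω := _
  change _ ≤ μ.real good
  -- Off `B1` at least `n/4` coordinates are large; off `B2` as well, more than `δn/16` of them are
  -- selected, each adding at least `ε²` to the sum.
  have hcover : (Set.univ : Set Ω) ⊆ good ∪ (B1 ∪ B2) := by
    intro ω _
    by_contra hω
    simp only [Set.mem_union, not_or] at hω
    obtain ⟨hgood, h1, h2⟩ := hω
    have hcard : δ * n / 16 < ∑ i ∈ J (ξ ω), sel i ω := by
      by_contra hle
      exact h2 ⟨not_lt.1 h1, not_lt.1 hle⟩
    set I := SubsampledConvolution.selectedSet sel ω with hI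
    have hsum : ∑ i ∈ J (ξ ω), sel i ω =
        ((I.filter fun i => ε ≤ |SubsampledConvolution.circConv a (ξ ω) i|).card : ℝ) := by
      have : I.filter (fun i => ε ≤ |SubsampledConvolution.circConv a (ξ ω) i|) =
          (J (ξ ω)).filter fun i => sel i ω = 1 := by
        ext i
        simp [hI, SubsampledConvolution.selectedSet, J, and_comm]
      rw [this, Finset.card_filter, Nat.cast_sum]
      refine Finset.sum_congr rfl fun i _ => ?_
      rcases hsel.zero_or_one i ω with h | h <;> simp [h]
    rw [hsum] at hcard
    refine hgood ⟨?_, by linarith⟩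
    calc 1 / 16 * ε ^ 2 * δ * n = ε ^ 2 * (δ * n / 16) := by ring
      _ ≤ ε ^ 2 * (I.filter fun i => ε ≤ |SubsampledConvolution.circConv a (ξ ω) i|).card :=
        mul_le_mul_of_nonneg_left hcard.le (sq_nonneg ε)
      _ = ∑ i ∈ I.filter fun i => ε ≤ |SubsampledConvolution.circConv a (ξ ω) i|, ε ^ 2 := by
        rw [Finset.sum_const, nsmul_eq_mul, mul_comm]
      _ ≤ ∑ i ∈ I.filter fun i => ε ≤ |SubsampledConvolution.circConv a (ξ ω) i|,
          SubsampledConvolution.circConv a (ξ ω) i ^ 2 := by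
        refine Finset.sum_le_sum fun i hi => ?_
        rw [← sq_abs (SubsampledConvolution.circConv a (ξ ω) i)]
        exact pow_le_pow_left₀ hε.le (Finset.mem_filter.1 hi).2 2
      _ ≤ _ := Finset.sum_le_sum_of_subset_of_nonneg (Finset.filter_subset _ _)
        fun i _ _ => sq_nonneg _
  have h1 := measureReal_mono (μ := μ) hcover
  rw [probReal_univ] at h1
  have h2 := h1.trans (measureReal_union_le _ _)
  have h3 := measureReal_union_le (μ := μ) B1 B2
  linarith
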